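/- Let $\mathcal P(\mathbb S^2)=\{f\in L^1(\mathbb S^2): f\ge 0 \text{ a.e.},\ \int_{\mathbb S^2} f\,dp=1\}$, where $dp$ is the two-dimensional Hausdorff measure on the unit sphere $\mathbb S^2\subset\mathbb R^3$. For $\eta\in\mathbb R$ and $f\in\mathcal P(\mathbb S^2)$ let $$\mathcal F(f,\eta)=\int_{\mathbb S^2} f(p)\ln f(p)-f(p)\ln\Big(\int_{\mathbb S^2}\big((p\cdot q)^2-\tfrac13\big)f(q)\,dq-\eta\Big)\,dp\in\mathbb R\cup\{+\infty\},$$ where $-\ln$ is extended by $+\infty$ to non-positive arguments and $0\cdot(+\infty)=0$. The Q-tensor of $f$ is $Q_f=\int_{\mathbb S^2}\big(p\otimes p-\tfrac13 I\big)f(p)\,dp$, and for $R\in \mathrm{SO}(3)$ let $[Rf]\in\mathcal P(\mathbb S^2)$ be given by $[Rf](p)=f(Rp)$. Let $e_1=(1,0,0)$. Proposition. Let $\eta_j<\tfrac23$ with $\eta_j\to\tfrac23$, and for each $j$ let $f_j$ be a global minimiser of $\mathcal F(\cdot,\eta_j)$ on $\mathcal P(\mathbb S^2)$. Then there exist rotations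 $R_j\in\mathrm{SO}(3)$ such that 1. $[R_jf_j]\overset{*}{\rightharpoonup}\tfrac12\big(\delta_{e_1}+\delta_{-e_1}\big)$ in $C(\mathbb S^2)^*$, that is, $\int_{\mathbb S^2}[R_jf_j](p)\,g(p)\,dp\to\tfrac12\big(g(e_1)+g(-e_1)\big)$ for every $g\in C(\mathbb S^2)$; 2. $Q_{[R_jf_j]}\to e_1\otimes e_1-\tfrac13 I$; 3. for every $\varepsilon>0$ and all sufficiently large $j$, $[R_jf_j]=0$ almost everywhere outside $\{p\in\mathbb S^2:(p\cdot e_1)^2>1-\varepsilon\}$. -/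

import Mathlib

open MeasureTheory Filter Topology

noncomputable section

namespace DenseNematic

/-- The unit sphere of three-dimensional Euclidean space. -/
abbrev S2 : Type := Metric.sphere (0 : EuclideanSpace ℝ (Fin 3)) 1

/-- The surface measure of the sphere: the two-dimensional Hausdorff measure, normalised so that in
the plane it agrees with the Lebesgue measure. -/
def sigma : Measure S2 := μHE[2]

/-- The group of rotations of three-dimensional space. -/
abbrev SO3 : Type := Matrix.specialOrthogonalGroup (Fin 3) ℝ

/-- The point `e₁ = (1, 0, 0)` of the sphere. -/
def e₁ : S2 := ⟨EuclideanSpace.single 0 1, by simp⟩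

/-- The dot product of two points of the sphere. -/
def dot (p q : S2) : ℝ := inner ℝ p.1 q.1

/-- The action of a rotation on the ambient space. -/
def rotVec (R : SO3) (x : EuclideanSpace ℝ (Fin 3)) : EuclideanSpace ℝ (Fin 3) :=
  WithLp.toLp 2 (R.1.mulVec x.ofLp)

theorem rotVec_sub (R : SO3) (x y : EuclideanSpace ℝ (Fin 3)) :
    rotVec R (x - y) = rotVec R x - rotVec R y := by
  simp [rotVec, Matrix.mulVec_sub]

theorem norm_rotVec (R : SO3) (x : EuclideanSpace ℝ (Fin 3)) : ‖rotVec R x‖ = ‖x‖ := by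
  have hR : R.1.transpose * R.1 = 1 := by
    have h := (Matrix.mem_specialOrthogonalGroup_iff.1 R.2).1
    exact (Matrix.mem_orthogonalGroup_iff' (Fin 3) ℝ).1 h
  have key : (R.1.mulVec x.ofLp) ⬝ᵥ (R.1.mulVec x.ofLp) = x.ofLp ⬝ᵥ x.ofLp := by
    rw [Matrix.dotProduct_mulVec, Matrix.vecMul_mulVec, ← Matrix.dotProduct_mulVec, hR,
      Matrix.one_mulVec]
  have key2 : ∑ i, (R.1.mulVec x.ofLp) i ^ 2 = ∑ i, x.ofLp i ^ 2 := by
    simpa [dotProduct, pow_two] using key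
  rw [EuclideanSpace.norm_eq, EuclideanSpace.norm_eq]
  simp only [Real.norm_eq_abs, sq_abs]
  exact congrArg Real.sqrt key2

/-- The action `p ↦ R p` of a rotation on the sphere. -/
def rot (R : SO3) (p : S2) : S2 :=
  ⟨rotVec R p.1, by
    have hp : ‖p.1‖ = 1 := by simp
    simp [norm_rotVec, hp]⟩

theorem isometry_rot (R : SO3) : Isometry (rot R) := by
  refine Isometry.of_dist_eq fun p q => ?_
  rw [Subtype.dist_eq, Subtype.dist_eq, dist_eq_norm, dist_eq_norm]
  change ‖rotVec R p.1 - rotVec R q.1‖ = _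
  rw [← rotVec_sub, norm_rotVec]

theorem rot_surjective (R : SO3) : Function.Surjective (rot R) := by
  intro p
  have h : R.1 * (R⁻¹).1 = 1 := by
    exact congrArg Subtype.val (mul_inv_cancel R)
  refine ⟨rot R⁻¹ p, Subtype.ext ?_⟩
  change WithLp.toLp 2 (R.1.mulVec ((R⁻¹).1.mulVec p.1.ofLp)) = p.1
  rw [Matrix.mulVec_mulVec, h, Matrix.one_mulVec]

theorem measurePreserving_rot (R : SO3) : MeasurePreserving (rot R) sigma sigma := by
  refine ⟨(isometry_rot R).continuous.measurable, ?_⟩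
  rw [sigma, (isometry_rot R).map_euclideanHausdorffMeasure, (rot_surjective R).range_eq,
    Measure.restrict_univ]

theorem measurableEmbedding_rot (R : SO3) : MeasurableEmbedding (rot R) :=
  (isometry_rot R).isClosedEmbedding.measurableEmbedding

/-- The probability distributions `𝒫(𝕊²)`: nonnegative integrable functions on the sphere with
integral one (represented by functions; everything below only depends on the a.e. class). -/
structure Density where
  /-- the underlying function -/
  toFun : S2 → ℝ
  integrable : Integrable toFun sigma
  nonneg : ∀ᵐ p ∂sigma, 0 ≤ toFun p
  integral_eq_one : ∫ p, toFun p ∂sigma = 1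

/-- The rotated distribution `[Rf](p) = f(Rp)`. -/
def Density.rotate (R : SO3) (f : Density) : Density where
  toFun p := f.toFun (rot R p)
  integrable :=
    ((measurePreserving_rot R).integrable_comp_emb (measurableEmbedding_rot R)).2 f.integrable
  nonneg := by
    have h := (measurePreserving_rot R).quasiMeasurePreserving.tendsto_ae
    exact h.eventually (p := fun q => 0 ≤ f.toFun q) f.nonneg
  integral_eq_one := by
    have h := (measurePreserving_rot R).integral_comp (measurableEmbedding_rot R) f.toFun
    exact h.trans f.integral_eq_one

/-- The Q-tensor `∫ (p ⊗ p - I/3) f(p) dp`, entrywise. -/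
def Density.qTensor (f : Density) : Matrix (Fin 3) (Fin 3) ℝ :=
  Matrix.of fun a b =>
    ∫ p : S2, (p.1 a * p.1 b - (1 / 3) * (1 : Matrix (Fin 3) (Fin 3) ℝ) a b) * f.toFun p ∂sigma

/-- `-ln`, extended by `+∞` to nonpositive arguments. -/
def negLog (x : ℝ) : EReal := if 0 < x then ((-Real.log x : ℝ) : EReal) else ⊤

/-- The integral of an extended real valued function, as the difference of the integrals of its
positive and its negative part. -/
def extIntegral (g : S2 → EReal) : EReal :=
  ((∫⁻ p, (g p).toENNReal ∂sigma : ENNReal) : EReal)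
    - ((∫⁻ p, (-g p).toENNReal ∂sigma : ENNReal) : EReal)

/-- The free energy
`∫ f(p) ln f(p) - f(p) ln (∫ ((p ⬝ q)² - 1/3) f(q) dq - η) dp` with values in the extended reals.
In `EReal`, `0 * ⊤ = 0`. The negative part of the integrand is bounded by a multiple of `1 + f`, so
that the value is never `-∞`. -/
def energy (f : Density) (η : ℝ) : EReal :=
  extIntegral fun p =>
    ((f.toFun p * Real.log (f.toFun p) : ℝ) : EReal)
      + (f.toFun p : EReal) *
        negLog ((∫ q, (dot p q ^ 2 - 1 / 3) * f.toFun q ∂sigma) - η)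

/-- `f` is a global minimiser of the free energy at the parameter `η`. -/
def IsGlobalMinimiser (f : Density) (η : ℝ) : Prop :=
  ∀ g : Density, energy f η ≤ energy g η

theorem Density.integrable_mul_continuous (f : Density) (g : C(S2, ℝ)) :
    Integrable (fun p => f.toFun p * g p) sigma :=
  f.integrable.mul_bdd (c := ‖g‖) g.continuous.aestronglyMeasurable
    (Eventually.of_forall fun p => g.norm_coe_le_norm p)

/-- A distribution `f` as the element `g ↦ ∫ f(p) g(p) dp` of the dual `C(𝕊²)*`, which carries the
weak-* topology. -/
def Density.toDual (f : Density) : WeakDual ℝ C(S2, ℝ) :=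
  StrongDual.toWeakDual <| LinearMap.mkContinuous
    { toFun := fun g => ∫ p, f.toFun p * g p ∂sigma
      map_add' := fun g h => by
        rw [← integral_add (f.integrable_mul_continuous g) (f.integrable_mul_continuous h)]
        simp [mul_add]
      map_smul' := fun c g => by
        rw [RingHom.id_apply, smul_eq_mul, ← integral_const_mul]
        simp [mul_left_comm] }
    1 fun g => by
      have h : ‖∫ p, f.toFun p * g p ∂sigma‖ ≤ ∫ p, f.toFun p * ‖g‖ ∂sigma := by
        refine norm_integral_le_of_norm_le (f.integrable.mul_const _) ?_
        filter_upwards [f.nonneg] with p hp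
        rw [norm_mul, Real.norm_of_nonneg hp]
        exact mul_le_mul_of_nonneg_left (g.norm_coe_le_norm p) hp
      rw [integral_mul_const, f.integral_eq_one] at h
      exact h

/-- The Dirac mass `δ_p` as the element `g ↦ g(p)` of `C(𝕊²)*`. -/
def dirac (p : S2) : WeakDual ℝ C(S2, ℝ) :=
  StrongDual.toWeakDual (ContinuousMap.evalCLM ℝ p)

end DenseNematic

end

open DenseNematic

/-!
Write `δ = 2/3 - η > 0`. Since `(p ⬝ q)² - 1/3 ≤ 2/3`, the argument of the logarithm in the free
energy is at most `δ`, and finiteness of the energy forces a strong concentration as `δ → 0`.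

*Finite energy.* The uniform distribution on a ball of radius of order `√δ` has finite energy
(`exists_energy_lt_top`), hence so has a minimiser `f`; the surface measure is finite and charges
balls, which is seen from spherical coordinates and from an orthogonal projection. Therefore
`∫ (p ⬝ q)² f(q) dq > 1 - δ` for almost every `p` in the support of `f` (`Density.ae_lt_potential`).

*Concentration on an axis.* Fix one such point `n`. For any other such `p` the average of
`(n ⬝ q)² + (p ⬝ q)²` exceeds `2 - 2δ`, so some `q` is nearly parallel to both `n` and `p`, which
gives `(p ⬝ n)² > 1 - 8δ` (`Density.exists_axis`). A rotation `R` taking `e₁` to `±n` moves this axis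
to `±e₁`.

*Evenness.* The interaction term is unchanged when `f` is replaced by its even part, whereas
`∫ f ln f` decreases strictly unless `f` is even, by strict convexity. So minimisers are even
(`IsGlobalMinimiser.ae_even`).

For even distributions a test function may be replaced by its even part, which is nearly constant on
the two small caps around `±e₁` carrying the mass; this is the weak-* convergence
(`tendsto_toDual`). The Q-tensor is the special case of the test functions `p_a p_b - δ_{ab}/3`.
-/

open MeasureTheory Filter Topology

noncomputable section

namespace DenseNematic

/-! ### The surface measure of the sphere -/

theorem sigma_apply (s : Set S2) :
    sigma s = (Measure.addHaarScalarFactor (volume : Measure (EuclideanSpace ℝ (Fin 2)))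
      μH[(2 : ℕ)] : ENNReal) * μH[2] s := by
  have h : μH[((2 : ℕ) : ℝ)] s = μH[2] s := by rw [Nat.cast_ofNat]
  rw [sigma, Measure.euclideanHausdorffMeasure_def, Measure.smul_apply, h]
  rfl

/-- Spherical coordinates, with polar angle first and azimuth second. -/
def sphericalCoord (t : ℝ × ℝ) : EuclideanSpace ℝ (Fin 3) :=
  !₂[Real.sin t.1 * Real.cos t.2, Real.sin t.1 * Real.sin t.2, Real.cos t.1]

theorem contDiff_sphericalCoord : ContDiff ℝ 1 sphericalCoord := by
  rw [contDiff_euclidean]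
  intro i
  fin_cases i <;> simp [sphericalCoord] <;> fun_prop

theorem exists_sphericalCoord_eq (p : S2) :
    ∃ t ∈ Set.Icc (0 : ℝ) Real.pi ×ˢ Set.Icc (-Real.pi) Real.pi, sphericalCoord t = p.1 := by
  have hp : p.1 0 ^ 2 + p.1 1 ^ 2 + p.1 2 ^ 2 = 1 := by
    have h : ‖p.1‖ ^ 2 = 1 := by simp
    rw [EuclideanSpace.norm_sq_eq] at h
    simpa [Fin.sum_univ_three] using h
  set w : ℂ := ⟨p.1 0, p.1 1⟩ with hw
  have hnorm : Real.sin (Real.arccos (p.1 2)) = ‖w‖ := by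
    rw [Real.sin_arccos, Complex.norm_def, Complex.normSq_apply]
    congr 1
    simp only [hw]
    linarith
  refine ⟨(Real.arccos (p.1 2), w.arg), ⟨⟨Real.arccos_nonneg _, Real.arccos_le_pi _⟩,
    ⟨(Complex.neg_pi_lt_arg w).le, Complex.arg_le_pi w⟩⟩, ?_⟩
  ext i
  fin_cases i
  · simp [sphericalCoord, hnorm, Complex.norm_mul_cos_arg, hw]
  · simp [sphericalCoord, hnorm, Complex.norm_mul_sin_arg, hw]
  · simp only [sphericalCoord]
    exact Real.cos_arccos (by nlinarith [sq_nonneg (p.1 0), sq_nonneg (p.1 1)])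
      (by nlinarith [sq_nonneg (p.1 0), sq_nonneg (p.1 1)])

/-- The sphere has finite area, being the image of a rectangle under the (Lipschitz) spherical
coordinates. -/
instance isFiniteMeasure_sigma : IsFiniteMeasure sigma := by
  refine ⟨?_⟩
  have hc : IsCompact (Set.Icc (0 : ℝ) Real.pi ×ˢ Set.Icc (-Real.pi) Real.pi) :=
    isCompact_Icc.prod isCompact_Icc
  obtain ⟨K, hK⟩ := LocallyLipschitzOn.exists_lipschitzOnWith_of_compact hc
    (contDiff_sphericalCoord.locallyLipschitz.locallyLipschitzOn)
  have h1 := hK.hausdorffMeasure_image_le (d := 2) zero_le_two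
  have h2 : μH[2] (Set.univ : Set S2) ≤ μH[2] (sphericalCoord '' (Set.Icc (0 : ℝ) Real.pi ×ˢ
      Set.Icc (-Real.pi) Real.pi)) := by
    rw [← (isometry_subtype_coe (s := Metric.sphere (0 : EuclideanSpace ℝ (Fin 3)) 1)
      ).hausdorffMeasure_image (Or.inl zero_le_two)]
    refine measure_mono ?_
    rintro _ ⟨p, -, rfl⟩
    exact exists_sphericalCoord_eq p
  rw [sigma_apply]
  refine ENNReal.mul_lt_top ENNReal.coe_lt_top (h2.trans_lt (h1.trans_lt ?_))
  rw [hausdorffMeasure_prod_real]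
  exact ENNReal.mul_lt_top (ENNReal.rpow_lt_top_of_nonneg zero_le_two ENNReal.coe_ne_top)
    hc.measure_lt_top

/-- Forgetting the first coordinate does not increase distances, and maps a ball around `e₁` onto
a set with interior; so the ball has positive area. -/
theorem sigma_ball_pos {r : ℝ} (hr : 0 < r) : 0 < sigma (Metric.ball e₁ r) := by
  let π : S2 → ℝ × ℝ := fun p => (p.1 1, p.1 2)
  have hπ : LipschitzWith 1 π := by
    refine LipschitzWith.of_dist_le_mul fun p q => ?_
    rw [NNReal.coe_one, one_mul, Prod.dist_eq, Subtype.dist_eq, dist_eq_norm p.1 q.1]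
    refine max_le ?_ ?_
    · exact PiLp.norm_apply_le (p.1 - q.1) 1
    · exact PiLp.norm_apply_le (p.1 - q.1) 2
  -- A right inverse of the projection near the origin.
  let g : ℝ × ℝ → EuclideanSpace ℝ (Fin 3) := fun t => !₂[√(1 - t.1 ^ 2 - t.2 ^ 2), t.1, t.2]
  have hg : Continuous g := by
    refine (PiLp.continuous_toLp 2 _).comp (continuous_pi fun i => ?_)
    fin_cases i <;> simp <;> fun_prop
  have hg0 : g 0 = e₁.1 := by
    ext i
    fin_cases i <;> simp [g, e₁]
  have hopen : IsOpen (g ⁻¹' Metric.ball e₁.1 r ∩ {t | t.1 ^ 2 + t.2 ^ 2 < 1}) :=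
    (Metric.isOpen_ball.preimage hg).inter (isOpen_lt (by fun_prop) continuous_const)
  have hne : (g ⁻¹' Metric.ball e₁.1 r ∩ {t | t.1 ^ 2 + t.2 ^ 2 < 1}).Nonempty :=
    ⟨0, by simp [hg0, hr], by simp⟩
  have hsub : g ⁻¹' Metric.ball e₁.1 r ∩ {t | t.1 ^ 2 + t.2 ^ 2 < 1} ⊆
      π '' Metric.ball e₁ r := by
    rintro t ⟨ht, ht1⟩
    have ht1' : 0 ≤ 1 - t.1 ^ 2 - t.2 ^ 2 := by
      have : t.1 ^ 2 + t.2 ^ 2 < 1 := ht1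
      linarith
    have hn : g t ∈ Metric.sphere (0 : EuclideanSpace ℝ (Fin 3)) 1 := by
      rw [mem_sphere_zero_iff_norm, EuclideanSpace.norm_eq]
      simp only [g, Fin.sum_univ_three, Real.norm_eq_abs, sq_abs]
      simp [Real.sq_sqrt ht1']
      ring
    exact ⟨⟨g t, hn⟩, ht, by simp [π, g]⟩
  have h1 : 0 < μH[2] (π '' Metric.ball e₁ r) := by
    rw [hausdorffMeasure_prod_real]
    exact (hopen.measure_pos volume hne).trans_le (measure_mono hsub)
  have h2 := hπ.hausdorffMeasure_image_le (d := 2) zero_le_two (Metric.ball e₁ r)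
  simp only [ENNReal.coe_one, ENNReal.one_rpow, one_mul] at h2
  rw [sigma_apply]
  refine ENNReal.mul_pos ?_ (h1.trans_le h2).ne'
  exact_mod_cast Measure.addHaarScalarFactor_volume_hausdorffMeasure_ne_zero 2

theorem isometry_neg_sphere : Isometry (fun p : S2 => -p) :=
  Isometry.of_dist_eq fun p q => by
    rw [Subtype.dist_eq, Subtype.dist_eq]
    exact dist_neg_neg _ _

theorem measurePreserving_neg : MeasurePreserving (fun p : S2 => -p) sigma sigma := by
  refine ⟨isometry_neg_sphere.continuous.measurable, ?_⟩
  rw [sigma, isometry_neg_sphere.map_euclideanHausdorffMeasure,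
    (neg_surjective (G := S2)).range_eq, Measure.restrict_univ]

theorem measurableEmbedding_neg : MeasurableEmbedding (fun p : S2 => -p) :=
  isometry_neg_sphere.isClosedEmbedding.measurableEmbedding

/-! ### The interaction potential -/

theorem continuous_dot : Continuous fun x : S2 × S2 => dot x.1 x.2 := by
  unfold dot
  fun_prop

theorem dot_neg_left (p q : S2) : dot (-p) q = -dot p q := inner_neg_left _ _

theorem dot_neg_right (p q : S2) : dot p (-q) = -dot p q := inner_neg_right _ _

theorem norm_sub_sq_sphere (p q : S2) : ‖p.1 - q.1‖ ^ 2 = 2 - 2 * dot p q := by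
  rw [norm_sub_sq_real]
  simp only [norm_eq_of_mem_sphere, dot]
  ring

theorem dot_sq_le_one (p q : S2) : dot p q ^ 2 ≤ 1 := by
  have h := abs_real_inner_le_norm p.1 q.1
  rw [norm_eq_of_mem_sphere, norm_eq_of_mem_sphere, one_mul] at h
  exact (sq_le_one_iff_abs_le_one _).2 h

/-- The mean field `p ↦ ∫ ((p ⬝ q)² - 1/3) f(q) dq` created by a distribution `f`. -/
def Density.potential (f : Density) (p : S2) : ℝ :=
  ∫ q, (dot p q ^ 2 - 1 / 3) * f.toFun q ∂sigma

theorem Density.integrable_potential (f : Density) (p : S2) :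
    Integrable (fun q => (dot p q ^ 2 - 1 / 3) * f.toFun q) sigma := by
  have hc : Continuous fun q => dot p q ^ 2 - 1 / 3 :=
    ((continuous_dot.comp (Continuous.prodMk_right p)).pow 2).sub continuous_const
  simpa only [mul_comm, ContinuousMap.coe_mk] using f.integrable_mul_continuous ⟨_, hc⟩

theorem Density.potential_le (f : Density) (p : S2) : f.potential p ≤ 2 / 3 := by
  have h : f.potential p ≤ ∫ q, 2 / 3 * f.toFun q ∂sigma := by
    refine integral_mono_ae (f.integrable_potential p) (f.integrable.const_mul _) ?_
    filter_upwards [f.nonneg] with q hq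
    have := dot_sq_le_one p q
    exact mul_le_mul_of_nonneg_right (by linarith) hq
  rwa [integral_const_mul, f.integral_eq_one, mul_one] at h

theorem Density.continuous_potential (f : Density) : Continuous f.potential := by
  refine continuous_of_dominated (bound := fun q => 1 * ‖f.toFun q‖)
    (fun p => (f.integrable_potential p).aestronglyMeasurable) (fun p => ?_)
    (f.integrable.norm.const_mul _) ?_
  · refine Eventually.of_forall fun q => ?_
    rw [norm_mul]
    refine mul_le_mul_of_nonneg_right ?_ (norm_nonneg _)
    rw [Real.norm_eq_abs, abs_le]
    have := dot_sq_le_one p q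
    constructor <;> nlinarith [sq_nonneg (dot p q)]
  · refine Eventually.of_forall fun q => ?_
    exact (((continuous_dot.comp (Continuous.prodMk_left q)).pow 2).sub
      continuous_const).mul continuous_const

/-! ### Extended integrals and finite energy -/

theorem extIntegral_congr {g h : S2 → EReal} (hgh : g =ᵐ[sigma] h) :
    extIntegral g = extIntegral h := by
  have h1 : ∫⁻ p, (g p).toENNReal ∂sigma = ∫⁻ p, (h p).toENNReal ∂sigma :=
    lintegral_congr_ae (hgh.fun_comp EReal.toENNReal)
  have h2 : ∫⁻ p, (-g p).toENNReal ∂sigma = ∫⁻ p, (-h p).toENNReal ∂sigma :=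
    lintegral_congr_ae (hgh.fun_comp fun x => (-x).toENNReal)
  rw [extIntegral, extIntegral, h1, h2]

theorem extIntegral_coe {g : S2 → ℝ} (hg : Integrable g sigma) :
    extIntegral (fun p => (g p : EReal)) = ((∫ p, g p ∂sigma : ℝ) : EReal) := by
  have h1 : ∫⁻ p, ENNReal.ofReal (g p) ∂sigma ≠ ⊤ := hg.lintegral_lt_top.ne
  have h2 : ∫⁻ p, ENNReal.ofReal (-g p) ∂sigma ≠ ⊤ := hg.neg.lintegral_lt_top.ne
  rw [integral_eq_lintegral_pos_part_sub_lintegral_neg_part hg, EReal.coe_sub,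
    EReal.coe_ennreal_toReal h1, EReal.coe_ennreal_toReal h2]
  simp only [extIntegral, ← EReal.coe_neg, EReal.real_coe_toENNReal]

theorem extIntegral_lt_top {g : S2 → EReal} (h : ∫⁻ p, (g p).toENNReal ∂sigma ≠ ⊤) :
    extIntegral g < ⊤ := by
  lift ∫⁻ p, (g p).toENNReal ∂sigma to NNReal using h with a ha
  rw [extIntegral, ← ha]
  refine lt_of_le_of_lt (EReal.sub_le_sub le_rfl (EReal.coe_ennreal_nonneg _)) ?_
  rw [sub_zero]
  exact EReal.coe_lt_top a

theorem lintegral_ne_top_of_extIntegral_lt_top {g : S2 → EReal} (h : extIntegral g < ⊤)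
    (hneg : ∫⁻ p, (-g p).toENNReal ∂sigma ≠ ⊤) : ∫⁻ p, (g p).toENNReal ∂sigma ≠ ⊤ := by
  intro htop
  lift ∫⁻ p, (-g p).toENNReal ∂sigma to NNReal using hneg with a ha
  rw [extIntegral, htop, ← ha] at h
  exact absurd h (by
    rw [EReal.coe_ennreal_top]
    have : ((a : ENNReal) : EReal) = ((a : ℝ) : EReal) := rfl
    rw [this, EReal.top_sub_coe]
    exact lt_irrefl _)

/-- The integrand of the free energy, as an extended real number. -/
def Density.integrand (f : Density) (η : ℝ) (p : S2) : EReal :=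
  ((f.toFun p * Real.log (f.toFun p) : ℝ) : EReal) +
    (f.toFun p : EReal) * negLog (f.potential p - η)

/-- The integrand of the free energy with the real logarithm in place of its extended version. The
two agree wherever `f` vanishes or its potential exceeds `η`. -/
def Density.realIntegrand (f : Density) (η : ℝ) (p : S2) : ℝ :=
  f.toFun p * Real.log (f.toFun p) - f.toFun p * Real.log (f.potential p - η)

theorem energy_eq (f : Density) (η : ℝ) : energy f η = extIntegral (f.integrand η) := rfl

theorem Density.integrand_eq_coe {f : Density} {η : ℝ} {p : S2}
    (h : f.toFun p ≠ 0 → η < f.potential p) : f.integrand η p = f.realIntegrand η p := by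
  unfold integrand realIntegrand
  by_cases h0 : f.toFun p = 0
  · simp [h0]
  · rw [negLog, if_pos (sub_pos.2 (h h0)), ← EReal.coe_mul, ← EReal.coe_add]
    congr 1
    ring

theorem Density.integrand_eq_top {f : Density} {η : ℝ} {p : S2}
    (h0 : 0 < f.toFun p) (h : f.potential p ≤ η) : f.integrand η p = ⊤ := by
  rw [integrand, negLog, if_neg (by linarith), EReal.coe_mul_top_of_pos h0, EReal.coe_add_top]

theorem Density.aestronglyMeasurable_realIntegrand (f : Density) (η : ℝ) :
    AEStronglyMeasurable (f.realIntegrand η) sigma := by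
  have h1 : AEMeasurable f.toFun sigma := f.integrable.aemeasurable
  have h2 : Measurable f.potential := f.continuous_potential.measurable
  exact ((h1.mul (Real.measurable_log.comp_aemeasurable h1)).sub
    (h1.mul (Real.measurable_log.comp (h2.sub_const η)).aemeasurable)).aestronglyMeasurable

theorem neg_one_le_mul_log {x : ℝ} (hx : 0 ≤ x) : -1 ≤ x * Real.log x := by
  rcases hx.eq_or_lt with rfl | hx
  · simp
  · have h := mul_le_mul_of_nonneg_left (Real.one_sub_inv_le_log_of_pos hx) hx.le
    rw [mul_sub, mul_inv_cancel₀ hx.ne'] at h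
    linarith

theorem Density.le_realIntegrand {f : Density} {η : ℝ} {p : S2} (h0 : 0 ≤ f.toFun p)
    (h : f.toFun p ≠ 0 → η < f.potential p) :
    -(1 + f.toFun p * |Real.log (2 / 3 - η)|) ≤ f.realIntegrand η p := by
  have h1 := neg_one_le_mul_log h0
  have h2 : f.toFun p * Real.log (f.potential p - η) ≤ f.toFun p * |Real.log (2 / 3 - η)| := by
    by_cases hf : f.toFun p = 0
    · simp [hf]
    · refine mul_le_mul_of_nonneg_left (le_trans ?_ (le_abs_self _)) h0
      exact Real.log_le_log (sub_pos.2 (h hf)) (by linarith [f.potential_le p])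
  unfold realIntegrand
  linarith

/-- The negative part of the energy integrand is integrable: `f ln f` is bounded below, and the
potential is bounded above. -/
theorem Density.lintegral_neg_integrand_ne_top (f : Density) (η : ℝ) :
    ∫⁻ p, (-f.integrand η p).toENNReal ∂sigma ≠ ⊤ := by
  have hint : Integrable (fun p => 1 + f.toFun p * |Real.log (2 / 3 - η)|) sigma :=
    (integrable_const 1).add (f.integrable.mul_const _)
  refine ne_top_of_le_ne_top hint.lintegral_lt_top.ne (lintegral_mono_ae ?_)
  filter_upwards [f.nonneg] with p hp
  by_cases h : f.toFun p ≠ 0 → η < f.potential p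
  · rw [integrand_eq_coe h, ← EReal.coe_neg, EReal.real_coe_toENNReal]
    exact ENNReal.ofReal_le_ofReal (by linarith [le_realIntegrand hp h])
  · push Not at h
    rw [integrand_eq_top (lt_of_le_of_ne hp h.1.symm) h.2]
    simp

/-- At finite energy, `f` vanishes almost everywhere outside the set where its potential exceeds
`η`. -/
theorem Density.ae_lt_potential {f : Density} {η : ℝ} (h : energy f η < ⊤) :
    ∀ᵐ p ∂sigma, f.toFun p ≠ 0 → η < f.potential p := by
  have hpos := lintegral_ne_top_of_extIntegral_lt_top h (f.lintegral_neg_integrand_ne_top η)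
  let B : Set S2 := {p | 0 < f.toFun p} ∩ {p | f.potential p ≤ η}
  have hB : NullMeasurableSet B sigma :=
    (nullMeasurableSet_lt aemeasurable_const f.integrable.aemeasurable).inter
      (measurableSet_le f.continuous_potential.measurable measurable_const).nullMeasurableSet
  have hle : ∫⁻ p, B.indicator (fun _ => ⊤) p ∂sigma ≤
      ∫⁻ p, (f.integrand η p).toENNReal ∂sigma := by
    refine lintegral_mono fun p => ?_
    by_cases hp : p ∈ B
    · rw [Set.indicator_of_mem hp, integrand_eq_top hp.1 hp.2, EReal.toENNReal_top]
    · rw [Set.indicator_of_notMem hp]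
      exact zero_le
  rw [lintegral_indicator₀ hB, setLIntegral_const] at hle
  have hB0 : sigma B = 0 := by
    by_contra hne
    exact hpos (top_le_iff.1 ((ENNReal.top_mul hne).symm.le.trans hle))
  have hae : ∀ᵐ p ∂sigma, p ∉ B := measure_eq_zero_iff_ae_notMem.1 hB0
  filter_upwards [f.nonneg, hae] with p hp hpB h0
  by_contra hlt
  exact hpB ⟨lt_of_le_of_ne hp h0.symm, not_lt.1 hlt⟩

theorem Density.integrand_ae_eq {f : Density} {η : ℝ}
    (h : ∀ᵐ p ∂sigma, f.toFun p ≠ 0 → η < f.potential p) :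
    f.integrand η =ᵐ[sigma] fun p => (f.realIntegrand η p : EReal) :=
  h.mono fun _ hp => integrand_eq_coe hp

theorem Density.integrable_realIntegrand {f : Density} {η : ℝ} (h : energy f η < ⊤) :
    Integrable (f.realIntegrand η) sigma := by
  have hneg := f.lintegral_neg_integrand_ne_top η
  have hpos : ∫⁻ p, (f.integrand η p).toENNReal ∂sigma ≠ ⊤ :=
    lintegral_ne_top_of_extIntegral_lt_top h hneg
  have hae := integrand_ae_eq (ae_lt_potential h)
  have hpos' : ∫⁻ p, ENNReal.ofReal (f.realIntegrand η p) ∂sigma < ⊤ :=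
    (lintegral_congr_ae (hae.fun_comp EReal.toENNReal)).symm.trans_lt hpos.lt_top
  have hneg' : ∫⁻ p, ENNReal.ofReal (-f.realIntegrand η p) ∂sigma < ⊤ :=
    (lintegral_congr_ae (hae.fun_comp fun x => (-x).toENNReal)).symm.trans_lt hneg.lt_top
  have hm := f.aestronglyMeasurable_realIntegrand η
  refine ⟨hm, ?_⟩
  have hle : ∫⁻ p, ‖f.realIntegrand η p‖ₑ ∂sigma ≤
      ∫⁻ p, (ENNReal.ofReal (f.realIntegrand η p) + ENNReal.ofReal (-f.realIntegrand η p))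
        ∂sigma := by
    refine lintegral_mono fun p => ?_
    rw [Real.enorm_eq_ofReal_abs]
    rcases abs_cases (f.realIntegrand η p) with h | h
    · rw [h.1]
      exact le_self_add
    · rw [h.1]
      exact le_add_self
  rw [lintegral_add_left' hm.aemeasurable.ennreal_ofReal] at hle
  exact hle.trans_lt (ENNReal.add_lt_top.2 ⟨hpos', hneg'⟩)

theorem energy_eq_integral {f : Density} {η : ℝ}
    (h : ∀ᵐ p ∂sigma, f.toFun p ≠ 0 → η < f.potential p)
    (hint : Integrable (f.realIntegrand η) sigma) :
    energy f η = ((∫ p, f.realIntegrand η p ∂sigma : ℝ) : EReal) := by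
  rw [energy_eq, extIntegral_congr (Density.integrand_ae_eq h), extIntegral_coe hint]

/-! ### Existence of distributions of finite energy -/

/-- The uniform distribution on the spherical ball of radius `r` around `e₁`. -/
def ballDensity (r : ℝ) (hr : 0 < r) : Density where
  toFun := (Metric.ball e₁ r).indicator fun _ => (sigma.real (Metric.ball e₁ r))⁻¹
  integrable := (integrable_const _).indicator Metric.isOpen_ball.measurableSet
  nonneg := Eventually.of_forall fun _ =>
    Set.indicator_nonneg (fun _ _ => inv_nonneg.2 measureReal_nonneg) _
  integral_eq_one := by
    rw [integral_indicator_const _ Metric.isOpen_ball.measurableSet, smul_eq_mul]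
    exact mul_inv_cancel₀ (ENNReal.toReal_pos (sigma_ball_pos hr).ne' (measure_ne_top _ _)).ne'

theorem one_sub_le_dot_sq_of_mem_ball {r : ℝ} {a p q : S2} (hp : p ∈ Metric.ball a r)
    (hq : q ∈ Metric.ball a r) : 1 - 4 * r ^ 2 ≤ dot p q ^ 2 := by
  have h1 : ‖p.1 - q.1‖ < 2 * r := by
    rw [← dist_eq_norm, ← Subtype.dist_eq]
    linarith [dist_triangle_right p q a, Metric.mem_ball.1 hp, Metric.mem_ball.1 hq]
  have h2 := norm_sub_sq_sphere p q
  nlinarith [norm_nonneg (p.1 - q.1), sq_nonneg (dot p q - 1)]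

/-- Below the critical value `2/3`, there are distributions of finite energy: the energy integrand
of the uniform distribution on a small ball is bounded. -/
theorem exists_energy_lt_top {η : ℝ} (hη : η < 2 / 3) : ∃ g : Density, energy g η < ⊤ := by
  set δ := 2 / 3 - η with hδ
  have hδ0 : 0 < δ := by linarith
  -- The radius is chosen so that the potential exceeds `η` by at least `δ / 2` on the ball.
  set r := √(δ / 8) with hr
  have hr0 : 0 < r := Real.sqrt_pos.2 (by linarith)
  have hr2 : r ^ 2 = δ / 8 := Real.sq_sqrt (by linarith)
  set g := ballDensity r hr0
  set c := (sigma.real (Metric.ball e₁ r))⁻¹ with hc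
  have hc0 : 0 ≤ c := inv_nonneg.2 measureReal_nonneg
  have hgm : ∀ p ∈ Metric.ball e₁ r, g.toFun p = c :=
    fun p hp => Set.indicator_of_mem hp fun _ => c
  have hgn : ∀ p ∉ Metric.ball e₁ r, g.toFun p = 0 :=
    fun p hp => Set.indicator_of_notMem hp fun _ => c
  have hpot : ∀ p ∈ Metric.ball e₁ r, δ / 2 ≤ g.potential p - η := by
    intro p hp
    have h : ∫ q, (2 / 3 - δ / 2) * g.toFun q ∂sigma ≤ g.potential p := by
      refine integral_mono (g.integrable.const_mul _) (g.integrable_potential p) fun q => ?_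
      by_cases hq : q ∈ Metric.ball e₁ r
      · have := one_sub_le_dot_sq_of_mem_ball hp hq
        simp only [hgm q hq]
        exact mul_le_mul_of_nonneg_right (by linarith) hc0
      · simp [hgn q hq]
    rw [integral_const_mul, g.integral_eq_one] at h
    linarith
  refine ⟨g, extIntegral_lt_top ?_⟩
  refine ne_top_of_le_ne_top (b := ∫⁻ _, ENNReal.ofReal (|c * Real.log c| +
    c * |Real.log (δ / 2)|) ∂sigma) ?_ (lintegral_mono fun p => ?_)
  · rw [lintegral_const]
    exact ENNReal.mul_ne_top ENNReal.ofReal_ne_top (measure_ne_top _ _)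
  · change (g.integrand η p).toENNReal ≤ _
    by_cases hp : p ∈ Metric.ball e₁ r
    · have h1 := hpot p hp
      rw [Density.integrand_eq_coe fun _ => by linarith, EReal.real_coe_toENNReal]
      refine ENNReal.ofReal_le_ofReal ?_
      have h2 : Real.log (δ / 2) ≤ Real.log (g.potential p - η) :=
        Real.log_le_log (by linarith) h1
      have h3 : c * -Real.log (g.potential p - η) ≤ c * |Real.log (δ / 2)| :=
        mul_le_mul_of_nonneg_left ((neg_le_neg h2).trans (neg_le_abs _)) hc0
      rw [Density.realIntegrand, hgm p hp]
      linarith [le_abs_self (c * Real.log c)]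
    · rw [Density.integrand_eq_coe fun h => absurd (hgn p hp) h, Density.realIntegrand, hgn p hp]
      simp

theorem IsGlobalMinimiser.energy_lt_top {f : Density} {η : ℝ} (h : IsGlobalMinimiser f η)
    (hη : η < 2 / 3) : energy f η < ⊤ := by
  obtain ⟨g, hg⟩ := exists_energy_lt_top hη
  exact (h g).trans_lt hg

/-! ### Minimisers are even -/

theorem integrable_neg_sphere {g : S2 → ℝ} (hg : Integrable g sigma) :
    Integrable (fun p => g (-p)) sigma :=
  (measurePreserving_neg.integrable_comp_emb measurableEmbedding_neg (g := g)).2 hg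

theorem ae_neg {P : S2 → Prop} (h : ∀ᵐ p ∂sigma, P p) : ∀ᵐ p ∂sigma, P (-p) :=
  measurePreserving_neg.quasiMeasurePreserving.tendsto_ae.eventually h

theorem integral_neg_sphere (g : S2 → ℝ) : ∫ p, g (-p) ∂sigma = ∫ p, g p ∂sigma :=
  measurePreserving_neg.integral_comp measurableEmbedding_neg g

theorem Density.potential_neg (f : Density) (p : S2) : f.potential (-p) = f.potential p := by
  simp only [potential, dot_neg_left, neg_sq]

/-- The even part of a distribution. -/
def Density.evenPart (f : Density) : Density where
  toFun p := (f.toFun p + f.toFun (-p)) / 2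
  integrable := (f.integrable.add (integrable_neg_sphere f.integrable)).div_const 2
  nonneg := by
    filter_upwards [f.nonneg, ae_neg f.nonneg] with p h1 h2
    positivity
  integral_eq_one := by
    rw [integral_div, integral_add f.integrable (integrable_neg_sphere f.integrable),
      integral_neg_sphere f.toFun, f.integral_eq_one]
    norm_num

theorem Density.potential_evenPart (f : Density) (p : S2) :
    f.evenPart.potential p = f.potential p := by
  let k : S2 → ℝ := fun q => (dot p q ^ 2 - 1 / 3) * f.toFun q
  have hk : (fun q => (dot p q ^ 2 - 1 / 3) * f.toFun (-q)) = fun q => k (-q) := by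
    funext q
    simp only [k]
    rw [dot_neg_right, neg_sq]
  have hint : Integrable (fun q => (dot p q ^ 2 - 1 / 3) * f.toFun (-q)) sigma := by
    rw [hk]
    exact integrable_neg_sphere (g := k) (f.integrable_potential p)
  have hneg : ∫ q, (dot p q ^ 2 - 1 / 3) * f.toFun (-q) ∂sigma = f.potential p := by
    rw [hk]
    exact integral_neg_sphere k
  have h : f.evenPart.potential p = ∫ q, ((dot p q ^ 2 - 1 / 3) * f.toFun q +
      (dot p q ^ 2 - 1 / 3) * f.toFun (-q)) / 2 ∂sigma := by
    refine integral_congr_ae (Eventually.of_forall fun q => ?_)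
    simp only [evenPart]
    ring
  rw [h, integral_div, integral_add (f.integrable_potential p) hint, hneg]
  change (f.potential p + f.potential p) / 2 = _
  ring

theorem mul_log_midpoint_lt {a b : ℝ} (ha : 0 ≤ a) (hb : 0 ≤ b) (hab : a ≠ b) :
    (a + b) / 2 * Real.log ((a + b) / 2) < (a * Real.log a + b * Real.log b) / 2 := by
  have h := Real.strictConvexOn_mul_log.2 ha hb hab (half_pos one_pos) (half_pos one_pos)
    (add_halves 1)
  simp only [smul_eq_mul] at h
  have e : 1 / 2 * a + 1 / 2 * b = (a + b) / 2 := by ring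
  rw [e] at h
  linarith

/-- The interaction energy does not change when a distribution is replaced by its even part,
whereas the entropy term drops strictly unless the distribution is even. -/
theorem IsGlobalMinimiser.ae_even {f : Density} {η : ℝ} (hf : IsGlobalMinimiser f η)
    (hη : η < 2 / 3) : ∀ᵐ p ∂sigma, f.toFun (-p) = f.toFun p := by
  have htop := hf.energy_lt_top hη
  have hsupp := Density.ae_lt_potential htop
  have hint := Density.integrable_realIntegrand htop
  have hint' : Integrable (fun p => f.realIntegrand η (-p)) sigma :=
    integrable_neg_sphere hint
  set g := f.evenPart with hg
  have hgsupp : ∀ᵐ p ∂sigma, g.toFun p ≠ 0 → η < g.potential p := by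
    filter_upwards [hsupp, ae_neg hsupp] with p h1 h2 h0
    rw [f.potential_neg] at h2
    rw [f.potential_evenPart]
    by_contra hlt
    refine h0 ?_
    simp only [hg, Density.evenPart, not_not.1 (mt h1 hlt), not_not.1 (mt h2 hlt)]
    norm_num
  -- The energy gain is the gap in the midpoint convexity of `x ln x`.
  have hgap : ∀ p, (f.realIntegrand η p + f.realIntegrand η (-p)) / 2 - g.realIntegrand η p =
      (f.toFun p * Real.log (f.toFun p) + f.toFun (-p) * Real.log (f.toFun (-p))) / 2 -
        (f.toFun p + f.toFun (-p)) / 2 * Real.log ((f.toFun p + f.toFun (-p)) / 2) := by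
    intro p
    simp only [Density.realIntegrand, hg, f.potential_evenPart, f.potential_neg]
    simp only [Density.evenPart]
    ring
  have hgap0 : 0 ≤ᵐ[sigma] fun p =>
      (f.realIntegrand η p + f.realIntegrand η (-p)) / 2 - g.realIntegrand η p := by
    filter_upwards [f.nonneg, ae_neg f.nonneg] with p h1 h2
    rw [Pi.zero_apply, hgap]
    rcases eq_or_ne (f.toFun p) (f.toFun (-p)) with h | h
    · rw [← h]
      simp
    · exact (sub_pos.2 (mul_log_midpoint_lt h1 h2 h)).le
  have havg : Integrable (fun p => (f.realIntegrand η p + f.realIntegrand η (-p)) / 2) sigma :=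
    (hint.add hint').div_const 2
  have hgint : Integrable (g.realIntegrand η) sigma := by
    refine integrable_of_le_of_le (g.aestronglyMeasurable_realIntegrand η) ?_ ?_
      ((integrable_const 1).add (g.integrable.mul_const |Real.log (2 / 3 - η)|)).neg havg
    · filter_upwards [g.nonneg, hgsupp] with p h1 h2
      exact Density.le_realIntegrand h1 h2
    · filter_upwards [hgap0] with p hp
      exact sub_nonneg.1 hp
  have hle := hf g
  rw [energy_eq_integral hsupp hint, energy_eq_integral hgsupp hgint, EReal.coe_le_coe_iff] at hle
  have havg_eq : ∫ p, (f.realIntegrand η p + f.realIntegrand η (-p)) / 2 ∂sigma =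
      ∫ p, f.realIntegrand η p ∂sigma := by
    rw [integral_div, integral_add hint hint', integral_neg_sphere (f.realIntegrand η)]
    ring
  have hzero : ∫ p, ((f.realIntegrand η p + f.realIntegrand η (-p)) / 2 - g.realIntegrand η p)
      ∂sigma = 0 := by
    refine le_antisymm ?_ (integral_nonneg_of_ae hgap0)
    rw [integral_sub havg hgint, havg_eq]
    exact sub_nonpos.2 hle
  rw [integral_eq_zero_iff_of_nonneg_ae hgap0 (havg.sub hgint)] at hzero
  filter_upwards [f.nonneg, ae_neg f.nonneg, hzero] with p h1 h2 h3
  by_contra hne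
  rw [hgap, Pi.zero_apply] at h3
  linarith [mul_log_midpoint_lt h1 h2 (Ne.symm hne)]

/-! ### Concentration of the support -/

/-- Two points whose directions are both close to that of `q` have directions close to each
other. -/
theorem lt_dot_sq_of_lt_dot_sq {n p q : S2} {δ : ℝ} (hδ : 0 < δ) (hn : 1 - 2 * δ < dot n q ^ 2)
    (hp : 1 - 2 * δ < dot p q ^ 2) : 1 - 8 * δ < dot p n ^ 2 := by
  set x := dot n q with hx
  set y := dot p q with hy
  -- Cauchy-Schwarz for the components of `p` and `n` orthogonal to `q`.
  have hcs : (dot p n - x * y) ^ 2 ≤ (1 - y ^ 2) * (1 - x ^ 2) := by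
    have h := real_inner_mul_inner_self_le (p.1 - y • q.1) (n.1 - x • q.1)
    have hqn : inner ℝ q.1 n.1 = x := real_inner_comm _ _
    have hqp : inner ℝ q.1 p.1 = y := real_inner_comm _ _
    have hnq : inner ℝ n.1 q.1 = x := rfl
    have hpq : inner ℝ p.1 q.1 = y := rfl
    have hpn : inner ℝ p.1 n.1 = dot p n := rfl
    simp only [inner_sub_left, inner_sub_right, real_inner_smul_left, real_inner_smul_right,
      real_inner_self_eq_norm_sq, norm_smul, mul_pow, Real.norm_eq_abs, sq_abs,
      norm_eq_of_mem_sphere, hqn, hqp, hnq, hpq, hpn] at h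
    nlinarith
  have hx1 : x ^ 2 ≤ 1 := dot_sq_le_one n q
  have hy1 : y ^ 2 ≤ 1 := dot_sq_le_one p q
  have hw1 : |x * y| ≤ 1 := by
    rw [← sq_le_one_iff_abs_le_one, mul_pow]
    exact mul_le_one₀ hx1 (sq_nonneg _) hy1
  have he : |dot p n - x * y| ≤ 2 * δ := by
    refine abs_le_of_sq_le_sq ?_ (by linarith)
    refine hcs.trans ?_
    rw [sq (2 * δ)]
    exact mul_le_mul (by linarith) (by linarith) (by linarith) (by linarith)
  have hprod : |x * y * (dot p n - x * y)| ≤ 2 * δ := by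
    rw [abs_mul]
    exact (mul_le_of_le_one_left (abs_nonneg _) hw1).trans he
  have hz : x ^ 2 * y ^ 2 - 4 * δ ≤ dot p n ^ 2 := by
    nlinarith [neg_le_of_abs_le hprod, sq_nonneg (dot p n - x * y)]
  by_cases h2 : 2 * δ ≤ 1
  · have := mul_le_mul hn.le hp.le (by linarith) (sq_nonneg _)
    nlinarith [sq_pos_of_pos hδ]
  · nlinarith [sq_nonneg (dot p n)]

/-- If the potential exceeds `η` on the support of `f`, then this support is concentrated around
an axis `±n`: any two of its points `n`, `p` satisfy
`∫ ((n ⬝ q)² + (p ⬝ q)²) f(q) dq > 2 - 2 (2/3 - η)`, so some `q` is nearly parallel to both. -/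
theorem Density.exists_axis {f : Density} {η : ℝ} (hη : η < 2 / 3)
    (hf : ∀ᵐ p ∂sigma, f.toFun p ≠ 0 → η < f.potential p) :
    ∃ n : S2, ∀ᵐ p ∂sigma, f.toFun p ≠ 0 → 1 - 8 * (2 / 3 - η) < dot p n ^ 2 := by
  obtain ⟨n, hn⟩ : ∃ n, η < f.potential n := by
    by_contra! h
    have h0 : f.toFun =ᵐ[sigma] 0 := by
      filter_upwards [hf] with p hp
      exact not_not.1 (mt hp (h p).not_gt)
    have h1 := f.integral_eq_one
    rw [integral_eq_zero_of_ae h0] at h1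
    exact zero_ne_one h1
  refine ⟨n, ?_⟩
  filter_upwards [hf] with p hp h0
  obtain ⟨q, hq1, hq2⟩ : ∃ q, 1 - 2 * (2 / 3 - η) < dot n q ^ 2 ∧
      1 - 2 * (2 / 3 - η) < dot p q ^ 2 := by
    by_contra! h
    have hle : ∫ q, ((dot n q ^ 2 - 1 / 3) * f.toFun q + (dot p q ^ 2 - 1 / 3) * f.toFun q)
        ∂sigma ≤ ∫ q, 2 * η * f.toFun q ∂sigma := by
      refine integral_mono_ae ((f.integrable_potential n).add (f.integrable_potential p))
        (f.integrable.const_mul _) ?_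
      filter_upwards [f.nonneg] with q hq
      rw [← add_mul]
      refine mul_le_mul_of_nonneg_right ?_ hq
      rcases le_or_gt (dot n q ^ 2) (1 - 2 * (2 / 3 - η)) with h1 | h1
      · linarith [dot_sq_le_one p q]
      · linarith [h q h1, dot_sq_le_one n q]
    rw [integral_add (f.integrable_potential n) (f.integrable_potential p), integral_const_mul,
      f.integral_eq_one] at hle
    have hpp : f.potential n + f.potential p ≤ 2 * η * 1 := hle
    linarith [hp h0]
  exact lt_dot_sq_of_lt_dot_sq (by linarith) hq1 hq2

/-! ### Rotating the axis onto `e₁` -/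

/-- The rotation by `π` about `e₁ + n`, which exchanges `e₁` and `n`; it is defined unless
`n = -e₁`. -/
theorem exists_rot_eq_of_nonneg {n : S2} (hn : 0 ≤ n.1 0) : ∃ R : SO3, rot R e₁ = n := by
  have h0 : n.1 0 ^ 2 + n.1 1 ^ 2 + n.1 2 ^ 2 = 1 := by
    have h : ‖n.1‖ ^ 2 = 1 := by simp
    rw [EuclideanSpace.norm_sq_eq] at h
    simpa [Fin.sum_univ_three] using h
  set a := n.1 0 with ha
  set b := n.1 1 with hb
  set c := n.1 2 with hc
  obtain ⟨k, h2⟩ : ∃ k, k * (1 + a) = 1 := ⟨(1 + a)⁻¹, inv_mul_cancel₀ (by linarith)⟩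
  have h1 : k * (b ^ 2 + c ^ 2) = 1 - a := by linear_combination k * h0 + (1 - a) * h2
  let M : Matrix (Fin 3) (Fin 3) ℝ :=
    !![a, b, c; b, k * b ^ 2 - 1, k * b * c; c, k * b * c, k * c ^ 2 - 1]
  have hM : M ∈ Matrix.specialOrthogonalGroup (Fin 3) ℝ := by
    rw [Matrix.mem_specialOrthogonalGroup_iff, Matrix.mem_orthogonalGroup_iff]
    constructor
    · ext i j
      fin_cases i <;> fin_cases j <;>
        simp [M, Matrix.mul_apply, Fin.sum_univ_three]
      · linear_combination h0
      · linear_combination b * h1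
      · linear_combination c * h1
      · linear_combination b * h1
      · linear_combination k * b ^ 2 * h1 - b ^ 2 * h2
      · linear_combination k * b * c * h1 - b * c * h2
      · linear_combination c * h1
      · linear_combination k * b * c * h1 - b * c * h2
      · linear_combination k * c ^ 2 * h1 - c ^ 2 * h2
    · rw [Matrix.det_fin_three]
      simp [M]
      linear_combination -a * h1 + h0
  refine ⟨⟨M, hM⟩, Subtype.ext ?_⟩
  ext i
  fin_cases i <;>
    simp [rot, rotVec, e₁, M, ha, hb, hc]

theorem dot_rot (R : SO3) (p q : S2) : dot (rot R p) (rot R q) = dot p q := by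
  have h := (isometry_rot R).dist_eq p q
  rw [Subtype.dist_eq, Subtype.dist_eq, dist_eq_norm, dist_eq_norm] at h
  have h1 := norm_sub_sq_sphere (rot R p) (rot R q)
  rw [h, norm_sub_sq_sphere] at h1
  linarith

theorem exists_dot_rot_sq_eq (n : S2) :
    ∃ R : SO3, ∀ p, dot (rot R p) n ^ 2 = dot p e₁ ^ 2 := by
  rcases le_total 0 (n.1 0) with h | h
  · obtain ⟨R, hR⟩ := exists_rot_eq_of_nonneg h
    exact ⟨R, fun p => by rw [← hR, dot_rot]⟩
  · have h' : 0 ≤ (-n).1 0 := by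
      change 0 ≤ -n.1 0
      linarith
    obtain ⟨R, hR⟩ := exists_rot_eq_of_nonneg h'
    refine ⟨R, fun p => ?_⟩
    rw [← neg_sq, ← dot_neg_right, ← hR, dot_rot]

theorem rot_neg (R : SO3) (p : S2) : rot R (-p) = -rot R p := by
  refine Subtype.ext ?_
  change rotVec R (-p.1) = -rotVec R p.1
  simp [rotVec, Matrix.mulVec_neg]

theorem ae_rot (R : SO3) {P : S2 → Prop} (h : ∀ᵐ p ∂sigma, P p) : ∀ᵐ p ∂sigma, P (rot R p) :=
  (measurePreserving_rot R).quasiMeasurePreserving.tendsto_ae.eventually h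

theorem IsGlobalMinimiser.exists_rotation {f : Density} {η : ℝ} (hf : IsGlobalMinimiser f η)
    (hη : η < 2 / 3) :
    ∃ R : SO3, (∀ᵐ p ∂sigma, (f.rotate R).toFun (-p) = (f.rotate R).toFun p) ∧
      ∀ᵐ p ∂sigma, (f.rotate R).toFun p ≠ 0 → 1 - 8 * (2 / 3 - η) < dot p e₁ ^ 2 := by
  obtain ⟨n, hn⟩ := Density.exists_axis hη (Density.ae_lt_potential (hf.energy_lt_top hη))
  obtain ⟨R, hR⟩ := exists_dot_rot_sq_eq n
  refine ⟨R, ?_, ?_⟩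
  · filter_upwards [ae_rot R (hf.ae_even hη)] with p hp
    simpa only [Density.rotate, rot_neg] using hp
  · filter_upwards [ae_rot R hn] with p hp
    rwa [hR] at hp

/-! ### Weak-* convergence of even, concentrating distributions -/

theorem Density.toDual_apply (f : Density) (g : C(S2, ℝ)) :
    f.toDual g = ∫ p, f.toFun p * g p ∂sigma := rfl

/-- Against an even distribution, a test function may be replaced by its even part. -/
theorem Density.abs_toDual_sub_le {f : Density}
    (heven : ∀ᵐ p ∂sigma, f.toFun (-p) = f.toFun p) (g : C(S2, ℝ)) {c κ : ℝ}
    (hg : ∀ᵐ p ∂sigma, f.toFun p ≠ 0 → |(g p + g (-p)) / 2 - c| ≤ κ) :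
    |f.toDual g - c| ≤ κ := by
  let g' : C(S2, ℝ) := ⟨fun p => g (-p), by fun_prop⟩
  have hi := f.integrable_mul_continuous g
  have hi' : Integrable (fun p => f.toFun p * g (-p)) sigma := f.integrable_mul_continuous g'
  have hneg : ∫ p, f.toFun p * g (-p) ∂sigma = ∫ p, f.toFun p * g p ∂sigma := by
    rw [← integral_neg_sphere fun p => f.toFun p * g p]
    refine integral_congr_ae ?_
    filter_upwards [heven] with p hp
    rw [hp]
  have h : f.toDual g - c = ∫ p, f.toFun p * ((g p + g (-p)) / 2 - c) ∂sigma := by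
    have h2 : ∫ p, ((f.toFun p * g p + f.toFun p * g (-p)) / 2 - f.toFun p * c) ∂sigma =
        ∫ p, (f.toFun p * g p + f.toFun p * g (-p)) / 2 ∂sigma - ∫ p, f.toFun p * c ∂sigma :=
      integral_sub ((hi.add hi').div_const 2) (f.integrable.mul_const c)
    rw [integral_div, integral_add hi hi', hneg, integral_mul_const, f.integral_eq_one] at h2
    rw [toDual_apply]
    calc _ = ∫ p, ((f.toFun p * g p + f.toFun p * g (-p)) / 2 - f.toFun p * c) ∂sigma := by
          rw [h2]
          ring
      _ = _ := integral_congr_ae (Eventually.of_forall fun p => by ring)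
  rw [h, ← Real.norm_eq_abs]
  refine (norm_integral_le_of_norm_le (f.integrable.mul_const κ) ?_).trans_eq ?_
  · filter_upwards [f.nonneg, hg] with p hp hgp
    rw [norm_mul, Real.norm_of_nonneg hp]
    by_cases h0 : f.toFun p = 0
    · simp [h0]
    · exact mul_le_mul_of_nonneg_left (hgp h0) hp
  · rw [integral_mul_const, f.integral_eq_one, one_mul]

theorem exists_abs_evenPart_sub_le (g : C(S2, ℝ)) {κ : ℝ} (hκ : 0 < κ) :
    ∃ ε > 0, ∀ p, 1 - ε < dot p e₁ ^ 2 →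
      |(g p + g (-p)) / 2 - (g e₁ + g (-e₁)) / 2| ≤ κ := by
  have hc : Continuous fun p => (g p + g (-p)) / 2 := by fun_prop
  obtain ⟨r, hr, h⟩ := Metric.continuous_iff.1 hc e₁ κ hκ
  have key : ∀ p, 0 ≤ dot p e₁ → 1 - r ^ 2 / 2 < dot p e₁ ^ 2 →
      |(g p + g (-p)) / 2 - (g e₁ + g (-e₁)) / 2| ≤ κ := by
    intro p h0 hp
    refine (h p ?_).le
    rw [Subtype.dist_eq, dist_eq_norm]
    refine lt_of_pow_lt_pow_left₀ 2 hr.le ?_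
    rw [norm_sub_sq_sphere]
    nlinarith [dot_sq_le_one p e₁]
  refine ⟨r ^ 2 / 2, by positivity, fun p hp => ?_⟩
  rcases le_total 0 (dot p e₁) with h0 | h0
  · exact key p h0 hp
  · have hneg := key (-p) (by rw [dot_neg_left]; linarith) (by rwa [dot_neg_left, neg_sq])
    rwa [neg_neg, add_comm (g (-p))] at hneg

theorem tendsto_toDual {F : ℕ → Density}
    (heven : ∀ j, ∀ᵐ p ∂sigma, (F j).toFun (-p) = (F j).toFun p)
    (hsupp : ∀ ε : ℝ, 0 < ε → ∀ᶠ j in atTop, ∀ᵐ p ∂sigma,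
      (F j).toFun p ≠ 0 → 1 - ε < dot p e₁ ^ 2) (g : C(S2, ℝ)) :
    Tendsto (fun j => (F j).toDual g) atTop (𝓝 ((g e₁ + g (-e₁)) / 2)) := by
  refine Metric.tendsto_nhds.2 fun κ hκ => ?_
  obtain ⟨ε, hε, h⟩ := exists_abs_evenPart_sub_le g (half_pos hκ)
  filter_upwards [hsupp ε hε] with j hj
  rw [Real.dist_eq]
  refine lt_of_le_of_lt ?_ (half_lt_self hκ)
  exact Density.abs_toDual_sub_le (heven j) g (hj.mono fun p hp h0 => h p (hp h0))

/-- The test function whose integrals are the entries of the Q-tensor. -/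
def qTest (a b : Fin 3) : C(S2, ℝ) where
  toFun p := p.1 a * p.1 b - (1 / 3) * (1 : Matrix (Fin 3) (Fin 3) ℝ) a b
  continuous_toFun := by fun_prop

theorem Density.qTensor_apply (f : Density) (a b : Fin 3) :
    f.qTensor a b = f.toDual (qTest a b) := by
  rw [toDual_apply]
  exact integral_congr_ae (Eventually.of_forall fun p => mul_comm _ _)

end DenseNematic

end

open DenseNematic
theorem mainTheorem12 (η : ℕ → ℝ) (f : ℕ → Density)
    (hη : ∀ j, η j < 2 / 3) (hlim : Tendsto η atTop (𝓝 (2 / 3)))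
    (hmin : ∀ j, IsGlobalMinimiser (f j) (η j)) :
    ∃ R : ℕ → SO3,
      Tendsto (fun j => ((f j).rotate (R j)).toDual) atTop
        (𝓝 ((1 / 2 : ℝ) • (dirac e₁ + dirac (-e₁)))) ∧
      Tendsto (fun j => ((f j).rotate (R j)).qTensor) atTop
        (𝓝 (Matrix.vecMulVec e₁.1.ofLp e₁.1.ofLp - (1 / 3 : ℝ) • (1 : Matrix (Fin 3) (Fin 3) ℝ))) ∧
      ∀ ε : ℝ, 0 < ε → ∀ᶠ j in atTop, ∀ᵐ p ∂sigma,
        ((f j).rotate (R j)).toFun p ≠ 0 → 1 - ε < dot p e₁ ^ 2 := by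
  choose R heven hR using fun j => (hmin j).exists_rotation (hη j)
  have hsupp : ∀ ε : ℝ, 0 < ε → ∀ᶠ j in atTop, ∀ᵐ p ∂sigma,
      ((f j).rotate (R j)).toFun p ≠ 0 → 1 - ε < dot p e₁ ^ 2 := by
    intro ε hε
    filter_upwards [hlim.eventually_const_lt (by linarith : 2 / 3 - ε / 8 < 2 / 3)] with j hj
    exact (hR j).mono fun p hp h0 => by linarith [hp h0]
  have hdual := tendsto_toDual heven hsupp
  refine ⟨R, ?_, ?_, hsupp⟩
  · refine tendsto_iff_forall_eval_tendsto_topDualPairing.2 fun g => ?_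
    have hval : topDualPairing ℝ C(S2, ℝ) ((1 / 2 : ℝ) • (dirac e₁ + dirac (-e₁))) g =
        (g e₁ + g (-e₁)) / 2 := by
      change (1 / 2 : ℝ) * (g e₁ + g (-e₁)) = _
      ring
    rw [hval]
    exact hdual g
  · refine tendsto_pi_nhds.2 fun a => tendsto_pi_nhds.2 fun b => ?_
    simp only [Density.qTensor_apply]
    convert hdual (qTest a b) using 2
    have hneg : (-e₁).1 = -e₁.1 := rfl
    simp only [qTest, ContinuousMap.coe_mk, hneg, Matrix.sub_apply, Matrix.vecMulVec_apply,
      Matrix.smul_apply, smul_eq_mul, PiLp.neg_apply]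
    ring
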